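/- Let $n\ge 0$ and let $\alpha=(\alpha_1,\dots,\alpha_k)$ be a composition of $n$. Its diagram has $\alpha_i$ left-justified cells in row $i$ (rows numbered from the top, columns from the left); the cell in row $i$ and column $j$ is $(i,j)$. A standard reverse composition tableau of shape $\alpha$ is a bijective filling $\tau$ of these cells with $1,\dots,n$ such that (1) the entries of each row decrease from left to right; (2) the entries of the first column increase from top to bottom; (3) if $i<j$, the cells $(i,k)$ and $(j,k+1)$ exist, and $\tau(i,k)>\tau(j,k+1)$, then the cell $(i,k+1)$ exists and $\tau(i,k+1)>\tau(j,k+1)$. Let $\mathrm{SRCT}(\alpha)$ be the set of these tableaux. For $1\le i\le n-1$, call $i$ a descent of $\tau$ if $i+1$ lies weakly to the right of $i$ (that is, in the same column or in a column further right). Say that $i$ and $i+1$ are attacking in $\tau$ if they are in the same column, or if $i+1$ is in the column immediately to the right of that of $i$ and in a strictly lower row. Put $\pi_i(\tau)=\tau$ if $i$ is not a descent of $\tau$; $\pi_i(\tau)=0$ if $i$ is a descent and $i,i+1$ are attacking; and otherwise let $\pi_i(\tau)$ be $\tau$ with the entries $i$ and $i+1$ interchanged. Put $\pi_i(0)=0$.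 For $\sigma\in\mathfrak S_n$ let $\pi_\sigma=\pi_{i_1}\cdots\pi_{i_p}$, where $s_{i_1}\cdots s_{i_p}$ is a reduced word for $\sigma$ in the adjacent transpositions $s_i=(i,i+1)$ (on $\mathrm{SRCT}(\alpha)$ this does not depend on the choice of the reduced word). Write $\tau_1\preccurlyeq_\alpha\tau_2$ if $\pi_\sigma(\tau_1)=\tau_2$ for some $\sigma\in\mathfrak S_n$. The column word $\mathrm{col}_\tau$ is obtained by reading the entries of each column from top to bottom, the columns being taken from left to right; it is regarded as a permutation in $\mathfrak S_n$ in one-line notation. The standardized column word $\mathrm{st}(\tau)$ is obtained in the same way after replacing each entry by its rank ($1,2,\dots$) among the entries of its column. Write $\tau_1\sim_\alpha\tau_2$ if $\mathrm{st}(\tau_1)=\mathrm{st}(\tau_2)$. A tableau is a source if, for every $i\in\{1,\dots,n-1\}$ that is not a descent, $i+1$ lies immediately to the left of $i$ in the same row; it is a sink if, for every descent $i$, $i$ and $i+1$ are attacking. Let $\le_L$ be the left weak Bruhat order on $\mathfrak S_n$: $\sigma_1\le_L\sigma_2$ if $\sigma_2=s_{i_r}\cdots s_{i_1}\sigma_1$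 for some $i_1,\dots,i_r$ with $\ell(s_{i_t}\cdots s_{i_1}\sigma_1)=\ell(\sigma_1)+t$ for $1\le t\le r$, where $\ell$ is the number of letters of a reduced word. **Theorem.** Let $E$ be an equivalence class of $\mathrm{SRCT}(\alpha)$ under $\sim_\alpha$. Then $(E,\preccurlyeq_\alpha)$ is a partially ordered set that is a graded lattice. The class $E$ contains exactly one source tableau $\tau_{0,E}$ and exactly one sink tableau $\tau_{1,E}$. The map $\tau\mapsto\mathrm{col}_\tau$ is an isomorphism of posets from $(E,\preccurlyeq_\alpha)$ onto the interval $[\mathrm{col}_{\tau_{0,E}},\mathrm{col}_{\tau_{1,E}}]=\{\sigma\in\mathfrak S_n : \mathrm{col}_{\tau_{0,E}}\le_L\sigma\le_L\mathrm{col}_{\tau_{1,E}}\}$ of $(\mathfrak S_n,\le_L)$. -/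

import Mathlib

namespace SRCTab

/-! ### The symmetric group and the left weak Bruhat order

Permutations of `{1, …, n}` are elements of `Equiv.Perm (Fin n)`; the letter `x` of the
mathematical text is the element `x - 1` of `Fin n`.  Adjacent transpositions are indexed by
`Fin (n - 1)`. -/

/-- The smaller of the two letters exchanged by the `i`-th adjacent transposition. -/
def lo {n : ℕ} (i : Fin (n - 1)) : Fin n := ⟨i.1, by have := i.2; omega⟩

/-- The larger of the two letters exchanged by the `i`-th adjacent transposition. -/
def hi {n : ℕ} (i : Fin (n - 1)) : Fin n := ⟨i.1 + 1, by have := i.2; omega⟩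

/-- The adjacent transposition `s_i = (i, i + 1)`. -/
def adjSwap {n : ℕ} (i : Fin (n - 1)) : Equiv.Perm (Fin n) := Equiv.swap (lo i) (hi i)

/-- The product `s_{i₁} ⋯ s_{i_p}` of a word `[i₁, …, i_p]`. -/
def wordProd {n : ℕ} (w : List (Fin (n - 1))) : Equiv.Perm (Fin n) := (w.map adjSwap).prod

/-- `w` is a reduced word for `σ`: an expression of `σ` as a product of adjacent transpositions
that uses the least possible number of them. -/
def IsReducedWord {n : ℕ} (w : List (Fin (n - 1))) (σ : Equiv.Perm (Fin n)) : Prop :=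
  wordProd w = σ ∧ ∀ w' : List (Fin (n - 1)), wordProd w' = σ → w.length ≤ w'.length

theorem exists_word {n : ℕ} (σ : Equiv.Perm (Fin n)) :
    ∃ w : List (Fin (n - 1)), wordProd w = σ := by
  cases n with
  | zero => exact ⟨[], Subsingleton.elim _ _⟩
  | succ m =>
    have h : σ ∈ Submonoid.closure
        (Set.range fun i : Fin m => Equiv.swap i.castSucc i.succ) := by
      rw [Equiv.Perm.mclosure_swap_castSucc_succ]
      trivial
    induction h using Submonoid.closure_induction with
    | mem x hx =>
      obtain ⟨i, rfl⟩ := hx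
      exact ⟨[i], by simp only [wordProd, List.map_cons, List.map_nil, List.prod_cons,
        List.prod_nil, mul_one]; rfl⟩
    | one => exact ⟨[], rfl⟩
    | mul x y _ _ hx hy =>
      obtain ⟨v, rfl⟩ := hx
      obtain ⟨w, rfl⟩ := hy
      exact ⟨v ++ w, by simp [wordProd]⟩

theorem exists_reducedWord {n : ℕ} (σ : Equiv.Perm (Fin n)) :
    ∃ w : List (Fin (n - 1)), IsReducedWord w σ := by
  obtain ⟨w, hw, hmin⟩ := exists_minimal_of_wellFoundedLT
    (fun k : ℕ => ∃ w : List (Fin (n - 1)), wordProd w = σ ∧ w.length = k)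
    (by obtain ⟨w, hw⟩ := exists_word σ; exact ⟨_, w, hw, rfl⟩)
  obtain ⟨v, hv, rfl⟩ := hw
  refine ⟨v, hv, fun w' hw' => ?_⟩
  by_contra hlt
  exact hlt (hmin ⟨w', hw', rfl⟩ (not_le.mp hlt).le)

/-- A reduced word for `σ`. -/
noncomputable def reducedWord {n : ℕ} (σ : Equiv.Perm (Fin n)) : List (Fin (n - 1)) :=
  (exists_reducedWord σ).choose

/-- The length `l(σ)`: the number of letters of a reduced word for `σ`. -/
noncomputable def len {n : ℕ} (σ : Equiv.Perm (Fin n)) : ℕ := (reducedWord σ).length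

/-- The left weak Bruhat order: `σ₁ ≤_L σ₂` if `σ₂ = s_{i_k} ⋯ s_{i_1} σ₁`, where each successive
multiplication on the left by an adjacent transposition increases the length by one. -/
def WeakLE {n : ℕ} : Equiv.Perm (Fin n) → Equiv.Perm (Fin n) → Prop :=
  Relation.ReflTransGen fun σ τ =>
    ∃ i : Fin (n - 1), τ = adjSwap i * σ ∧ len τ = len σ + 1

/-- The interval `[σ₁, σ₂]` of the left weak Bruhat order. -/
def weakInterval {n : ℕ} (σ₁ σ₂ : Equiv.Perm (Fin n)) : Set (Equiv.Perm (Fin n)) :=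
  {σ | WeakLE σ₁ σ ∧ WeakLE σ σ₂}

/-! ### Fillings of reverse composition diagrams -/

/-- The cells of the reverse composition diagram of `α`: the row index (from the top) together
with the column index (from the left), both counted from `0`; row `i` has `α_i` cells. -/
abbrev Cell {n : ℕ} (α : Composition n) : Type := Σ i : Fin α.length, Fin (α.blocksFun i)

/-- Bijective fillings of the diagram of `α` with the letters `1, …, n`. -/
abbrev Filling {n : ℕ} (α : Composition n) : Type := Cell α ≃ Fin n

/-- The row of the cell that contains the letter `x`. -/
def rowOf {n : ℕ} {α : Composition n} (T : Filling α) (x : Fin n) : ℕ := (T.symm x).1.1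

/-- The column of the cell that contains the letter `x`. -/
def colOf {n : ℕ} {α : Composition n} (T : Filling α) (x : Fin n) : ℕ := (T.symm x).2.1

/-- The conditions on a filling to be a standard reverse composition tableau. -/
structure IsSRCT {n : ℕ} {α : Composition n} (T : Filling α) : Prop where
  /-- The entries of each row decrease from left to right. -/
  row_decreasing : ∀ (i : Fin α.length) (k l : Fin (α.blocksFun i)),
    k < l → T ⟨i, l⟩ < T ⟨i, k⟩
  /-- The entries of the first column increase from top to bottom. -/
  first_column_increasing : ∀ (i j : Fin α.length)
    (hi : 0 < α.blocksFun i) (hj : 0 < α.blocksFun j), i < j → T ⟨i, ⟨0, hi⟩⟩ < T ⟨j, ⟨0, hj⟩⟩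
  /-- The triple rule. -/
  triple : ∀ (i j : Fin α.length) (k : ℕ) (hi : k < α.blocksFun i) (hj : k + 1 < α.blocksFun j),
    i < j → T ⟨j, ⟨k + 1, hj⟩⟩ < T ⟨i, ⟨k, hi⟩⟩ →
      ∃ h : k + 1 < α.blocksFun i, T ⟨j, ⟨k + 1, hj⟩⟩ < T ⟨i, ⟨k + 1, h⟩⟩

/-- `SRCT α` is the set of standard reverse composition tableaux of shape `α`. -/
def SRCT {n : ℕ} (α : Composition n) : Type := {T : Filling α // IsSRCT T}

/-! ### The operators `π_i`, `π_σ` and the order `≼_α` -/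

/-- `i` is a descent: `i + 1` appears weakly right of `i`. -/
def IsDescent {n : ℕ} {α : Composition n} (T : Filling α) (i : Fin (n - 1)) : Prop :=
  colOf T (lo i) ≤ colOf T (hi i)

/-- `i` and `i + 1` are attacking: they are in the same column, or `i + 1` is in the column
immediately to the right of that of `i`, and in a strictly lower row. -/
def Attacking {n : ℕ} {α : Composition n} (T : Filling α) (i : Fin (n - 1)) : Prop :=
  colOf T (lo i) = colOf T (hi i) ∨
    (colOf T (hi i) = colOf T (lo i) + 1 ∧ rowOf T (lo i) < rowOf T (hi i))

/-- The filling obtained by interchanging the positions of the entries `i` and `i + 1`. -/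
def switch {n : ℕ} {α : Composition n} (i : Fin (n - 1)) (T : Filling α) : Filling α :=
  T.trans (adjSwap i)

open Classical in
/-- The operator `π_i`; the value `none` stands for `0`. -/
noncomputable def flip {n : ℕ} {α : Composition n} (i : Fin (n - 1)) (T : Filling α) :
    Option (Filling α) :=
  if ¬ IsDescent T i then some T
  else if Attacking T i then none
  else some (switch i T)

/-- The composite `π_{i₁} ⋯ π_{i_p}` for a word `[i₁, …, i_p]`; the rightmost operator acts first,
and every operator sends `0` to `0`. -/
noncomputable def flipWord {n : ℕ} {α : Composition n} (w : List (Fin (n - 1))) (T : Filling α) :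
    Option (Filling α) :=
  w.foldr (fun i o => o.bind (flip i)) (some T)

/-- The operator `π_σ = π_{i₁} ⋯ π_{i_p}`, where `s_{i₁} ⋯ s_{i_p}` is a reduced word for `σ`. -/
noncomputable def flipPerm {n : ℕ} {α : Composition n} (σ : Equiv.Perm (Fin n)) (T : Filling α) :
    Option (Filling α) :=
  flipWord (reducedWord σ) T

/-- The order `≼_α` on standard reverse composition tableaux of shape `α`. -/
def FlipLE {n : ℕ} {α : Composition n} (S T : SRCT α) : Prop :=
  ∃ σ : Equiv.Perm (Fin n), flipPerm σ S.1 = some T.1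

/-! ### Column words -/

/-- The entries of column `j`, read from top to bottom (empty if there is no such column). -/
def columnWord {n : ℕ} {α : Composition n} (T : Filling α) (j : ℕ) : List (Fin n) :=
  (List.finRange α.length).filterMap fun i =>
    if h : j < α.blocksFun i then some (T ⟨i, ⟨j, h⟩⟩) else none

/-- The column word: the words of the columns, from left to right.  There are at most `n`
columns. -/
def colWord {n : ℕ} {α : Composition n} (T : Filling α) : List (Fin n) :=
  (List.range n).flatMap (columnWord T)

theorem mem_columnWord {n : ℕ} {α : Composition n} (T : Filling α) (j : ℕ) (x : Fin n) :
    x ∈ columnWord T j ↔ colOf T x = j := by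
  simp only [columnWord, List.mem_filterMap, List.mem_finRange, true_and, colOf]
  constructor
  · rintro ⟨i, hi⟩
    split_ifs at hi with h
    have hx : T ⟨i, ⟨j, h⟩⟩ = x := Option.some.inj hi
    rw [← hx, Equiv.symm_apply_apply]
  · rintro rfl
    refine ⟨(T.symm x).1, ?_⟩
    rw [dif_pos (T.symm x).2.2]
    exact congrArg some (T.apply_symm_apply x)

theorem nodup_columnWord {n : ℕ} {α : Composition n} (T : Filling α) (j : ℕ) :
    (columnWord T j).Nodup := by
  refine List.Nodup.filterMap ?_ (List.nodup_finRange _)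
  intro i i' x hx hx'
  simp only [Option.mem_def] at hx hx'
  split_ifs at hx with h
  split_ifs at hx' with h'
  have e := T.injective ((Option.some.inj hx).trans (Option.some.inj hx').symm)
  exact congrArg Sigma.fst e

theorem mem_colWord {n : ℕ} {α : Composition n} (T : Filling α) (x : Fin n) :
    x ∈ colWord T := by
  simp only [colWord, List.mem_flatMap, List.mem_range, mem_columnWord]
  exact ⟨_, lt_of_lt_of_le (T.symm x).2.2 (α.blocksFun_le _), rfl⟩

theorem nodup_colWord {n : ℕ} {α : Composition n} (T : Filling α) : (colWord T).Nodup := by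
  rw [colWord, List.nodup_flatMap]
  refine ⟨fun j _ => nodup_columnWord T j, List.Pairwise.imp ?_ List.nodup_range⟩
  intro j k hjk x hx hx'
  rw [mem_columnWord] at hx hx'
  exact hjk (hx.symm.trans hx')

theorem length_colWord {n : ℕ} {α : Composition n} (T : Filling α) : (colWord T).length = n := by
  simpa using Fintype.card_congr
    (List.Nodup.getEquivOfForallMemList _ (nodup_colWord T) (mem_colWord T))

/-- The column word as a permutation: `col T` has one-line notation `colWord T`, that is,
`col T p` is the letter of `colWord T` in position `p`. -/
def col {n : ℕ} {α : Composition n} (T : Filling α) : Equiv.Perm (Fin n) :=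
  (finCongr (length_colWord T).symm).trans
    (List.Nodup.getEquivOfForallMemList _ (nodup_colWord T) (mem_colWord T))

/-- The standardization of a word with distinct letters: each letter is replaced by its rank
`1, 2, …` among the letters of the word. -/
def standardize {n : ℕ} (w : List (Fin n)) : List ℕ :=
  w.map fun x => w.countP fun y => decide (y ≤ x)

/-- The standardized column word: the standardizations of the words of the columns, from left to
right. -/
def st {n : ℕ} {α : Composition n} (T : Filling α) : List ℕ :=
  (List.range n).flatMap fun j => standardize (columnWord T j)

/-- The equivalence relation `∼_α`: equality of standardized column words. -/
def stSetoid {n : ℕ} (α : Composition n) : Setoid (SRCT α) := Setoid.ker fun T => st T.1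

/-! ### Source and sink tableaux -/

/-- A source tableau: if `i ≠ n` is not a descent then `i + 1` lies to the immediate left
of `i`. -/
def IsSource {n : ℕ} {α : Composition n} (T : SRCT α) : Prop :=
  ∀ i : Fin (n - 1), ¬ IsDescent T.1 i →
    rowOf T.1 (hi i) = rowOf T.1 (lo i) ∧ colOf T.1 (hi i) + 1 = colOf T.1 (lo i)

/-- A sink tableau: if `i` is a descent then `i` and `i + 1` are attacking. -/
def IsSink {n : ℕ} {α : Composition n} (T : SRCT α) : Prop :=
  ∀ i : Fin (n - 1), IsDescent T.1 i → Attacking T.1 i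

end SRCTab

/-!
An equivalence class consists of all fillings that order the entries of certain pairs of cells, the
edges, in one fixed way. The edges are the pairs in a common column and the pairs `(i, k)`,
`(j, k + 1)` with `i ≤ j`. Indeed the triple rule expresses the relative order on an edge of the
second kind by the relative order in column `k + 1` (`IsSRCT.edgeAgree`), and conversely the
conditions on a tableau only involve edges (`EdgeAgree.isSRCT`). So a class is the set of
linear extensions of an acyclic orientation of a graph on the cells.

Let the cells be ordered by reading the columns. If a cell is read between the two ends of an edge,
then it is in the same column as one of them, hence joined to it (`isSpanned_edge`). For a graph on
a linear order with this property, every set of linear orders inducing a given orientation is an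
interval of the weak order. Indeed the betweenness property passes to the transitive closure of the
orientation (`transGen_between`), and it follows that the inversions of a locally minimal element
are all implied by the orientation (`Agree.invLE_of_locallyMinimal`); so a locally minimal element
is the minimum, and dually. The class is convex, because the orders of the edges are squeezed
between equal ones (`Agree.of_invLE`), and sources and sinks are exactly the local minima and
maxima.

The weak order is containment of inversion sets (`weakLE_iff_invLE`), length being the number of
inversions. It is a lattice since the transitive closure of a union of inversion sets is an
inversion set (`exists_sup`, again by `transGen_between`), and the class, being an interval, is a
sublattice graded by length. Finally the operator `π_i` moves one step up in the weak order inside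
the class, or fixes the tableau, or gives `0`, where an attacking pair is an edge. So for two
tableaux of a class any word whose length is the difference of the lengths of their column words,
and that leads from one column word to the other, does the same for the tableaux
(`EdgeAgree.flipLE_iff`). This makes any comparison of reduced words with each other unnecessary.
-/

namespace SRCTab

open Relation

/-! ### Agreement classes of linear orders -/

section Classes

/-- `σ` and `τ` order every pair of adjacent vertices of the graph `G` in the same way: they induce
the same orientation of `G`. -/
def Agree {V : Type*} {n : ℕ} (G : V → V → Prop) (σ τ : V ≃ Fin n) : Prop :=
  ∀ x z, G x z → (σ x < σ z ↔ τ x < τ z)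

variable {V : Type*} [LinearOrder V] {n : ℕ}

/-- Containment of inversion sets. The positions form a linear order `V`, and a pair `x < z` is an
inversion of `σ` if `σ z < σ x`. For permutations this is the left weak order, see
`weakLE_iff_invLE`. -/
def InvLE (σ τ : V ≃ Fin n) : Prop :=
  ∀ x z : V, x < z → σ z < σ x → τ z < τ x

theorem InvLE.refl (σ : V ≃ Fin n) : InvLE σ σ := fun _ _ _ h => h

theorem InvLE.trans {σ τ ρ : V ≃ Fin n} (h : InvLE σ τ) (h' : InvLE τ ρ) : InvLE σ ρ :=
  fun x z hxz hσ => h' x z hxz (h x z hxz hσ)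

/-- Reversing the order of the positions exchanges inversions and non-inversions. Facts about
maxima and infima follow from those about minima and suprema in this way. -/
theorem invLE_dual {σ τ : V ≃ Fin n} :
    InvLE (V := Vᵒᵈ) (OrderDual.ofDual.trans σ) (OrderDual.ofDual.trans τ) ↔ InvLE τ σ := by
  constructor
  · intro h x z hxz hτ
    by_contra hσ
    have hne : σ x ≠ σ z := σ.injective.ne hxz.ne
    exact lt_asymm hτ (h (OrderDual.toDual z) (OrderDual.toDual x) hxz
      (lt_of_le_of_ne (not_lt.mp hσ) hne))
  · intro h x z hxz hσ
    by_contra hτ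
    have hne : τ (OrderDual.ofDual x) ≠ τ (OrderDual.ofDual z) :=
      τ.injective.ne (OrderDual.ofDual.injective.ne hxz.ne)
    exact lt_asymm hσ (h (OrderDual.ofDual z) (OrderDual.ofDual x) hxz
      (lt_of_le_of_ne (not_lt.mp hτ) hne))

/-- `y` lies strictly between `u` and `v`, in either direction. -/
def Between (u y v : V) : Prop := (u < y ∧ y < v) ∨ (v < y ∧ y < u)

/-- The splitting property `u R v → u R y ∨ y R v` for `y` between `u` and `v` passes from a
relation to its transitive closure: along a chain from `u` to `v` some step jumps over `y` or
stops at it. -/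
theorem transGen_between {R : V → V → Prop}
    (hR : ∀ u y v, R u v → Between u y v → TransGen R u y ∨ TransGen R y v) {u y v : V}
    (h : TransGen R u v) (hy : Between u y v) : TransGen R u y ∨ TransGen R y v := by
  induction h using TransGen.head_induction_on with
  | single h => exact hR _ _ _ h hy
  | @head a c hac hcv ih =>
    rcases eq_or_ne y c with rfl | hne
    · exact Or.inl (.single hac)
    · have : Between a y c ∨ Between c y v := by
        unfold Between at *
        rcases lt_or_gt_of_ne hne with h | h <;> tauto
      rcases this with h | h
      · exact (hR _ _ _ hac h).imp_right fun h => h.trans hcv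
      · exact (ih h).imp_left fun h => .head hac h

/-- The condition on a graph on a linear order under which each of its agreement classes is an
interval of the weak order: whenever an edge jumps over a vertex, that vertex is adjacent to one of
its ends. -/
structure IsSpanned (G : V → V → Prop) : Prop where
  symm : ∀ x y, G x y → G y x
  between : ∀ x y z, x < y → y < z → G x z → G x y ∨ G y z

theorem IsSpanned.dual {G : V → V → Prop} (hG : IsSpanned G) :
    IsSpanned (V := Vᵒᵈ) fun x y => G (OrderDual.ofDual x) (OrderDual.ofDual y) where
  symm x y := hG.symm (OrderDual.ofDual x) (OrderDual.ofDual y)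
  between x y z hxy hyz h := by
    rcases hG.between (OrderDual.ofDual z) (OrderDual.ofDual y) (OrderDual.ofDual x) hyz hxy
      (hG.symm _ _ h) with h | h
    · exact Or.inr (hG.symm _ _ h)
    · exact Or.inl (hG.symm _ _ h)

/-- Agreement classes are convex for containment of inversion sets. -/
theorem Agree.of_invLE {G : V → V → Prop} (hG : IsSpanned G) {σ τ ρ : V ≃ Fin n}
    (h : Agree G σ ρ) (h₁ : InvLE σ τ) (h₂ : InvLE τ ρ) : Agree G σ τ := by
  have key : ∀ x z, x < z → G x z → (σ z < σ x ↔ τ z < τ x) := fun x z hxz hg =>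
    ⟨h₁ x z hxz, fun ht => (h z x (hG.symm _ _ hg)).mpr (h₂ x z hxz ht)⟩
  intro x z hg
  rcases lt_trichotomy x z with hxz | rfl | hxz
  · have h₁ := key x z hxz hg
    have h₂ : σ x ≠ σ z := σ.injective.ne hxz.ne
    have h₃ : τ x ≠ τ z := τ.injective.ne hxz.ne
    rw [← not_iff_not, not_lt, not_lt, h₂.symm.le_iff_lt, h₃.symm.le_iff_lt, h₁]
  · simp
  · exact key z x hxz (hG.symm _ _ hg)

/-- If every pair of consecutive values that is inverted in `σ` is an edge, then every inversion of
`σ` is forced: it follows by transitivity from the orientation of `G` induced by `σ`. Hence `σ` has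
the least inversion set in its class. -/
theorem Agree.invLE_of_locallyMinimal {G : V → V → Prop} (hG : IsSpanned G) {σ τ : V ≃ Fin n}
    (h : Agree G σ τ)
    (hσ : ∀ x z, x < z → (σ x : ℕ) = σ z + 1 → G x z) : InvLE σ τ := by
  set R : V → V → Prop := fun u v => G u v ∧ σ v < σ u with hR
  have hRσ : ∀ u v, TransGen R u v → σ v < σ u := by
    intro u v huv
    induction huv with
    | single h => exact h.2
    | tail _ h ih => exact h.2.trans ih
  have hRτ : ∀ u v, TransGen R u v → τ v < τ u := by
    intro u v huv
    induction huv with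
    | single h' => exact (h _ _ (hG.symm _ _ h'.1)).mp h'.2
    | tail _ h' ih => exact ((h _ _ (hG.symm _ _ h'.1)).mp h'.2).trans ih
  have hstep : ∀ u y v, R u v → Between u y v → TransGen R u y ∨ TransGen R y v := by
    intro u y v huv hy
    have hGy : G u y ∨ G y v := by
      rcases hy with ⟨h₁, h₂⟩ | ⟨h₁, h₂⟩
      · exact hG.between _ _ _ h₁ h₂ huv.1
      · exact (hG.between _ _ _ h₁ h₂ (hG.symm _ _ huv.1)).symm.imp (hG.symm _ _) (hG.symm _ _)
    have hne : u ≠ y ∧ y ≠ v := by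
      rcases hy with ⟨h₁, h₂⟩ | ⟨h₁, h₂⟩
      · exact ⟨h₁.ne, h₂.ne⟩
      · exact ⟨h₂.ne', h₁.ne'⟩
    rcases hGy with hg | hg
    · rcases lt_or_gt_of_ne (σ.injective.ne hne.1) with hlt | hlt
      · exact Or.inr (.tail (.single ⟨hG.symm _ _ hg, hlt⟩) huv)
      · exact Or.inl (.single ⟨hg, hlt⟩)
    · rcases lt_or_gt_of_ne (σ.injective.ne hne.2) with hlt | hlt
      · exact Or.inl (.tail (.single huv) ⟨hG.symm _ _ hg, hlt⟩)
      · exact Or.inr (.single ⟨hg, hlt⟩)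
  -- Induction on the difference of the two values; `y` carries the value next to that of `z`.
  -- If `y` lies between `x` and `z`, both parts are shorter inversions. Otherwise a forced pair
  -- jumps over `x` or `z` and is split there; one of the two parts contradicts the order of `σ`.
  have forced : ∀ d : ℕ, ∀ x z, x < z → (σ x : ℕ) = σ z + (d + 1) → TransGen R x z := by
    intro d
    induction d using Nat.strong_induction_on with
    | _ d ih =>
      intro x z hxz hd
      rcases Nat.eq_zero_or_pos d with rfl | hpos
      · exact .single ⟨hσ x z hxz hd, by rw [Fin.lt_def]; omega⟩
      · obtain ⟨y, hy⟩ : ∃ y, (σ y : ℕ) = σ z + 1 :=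
          ⟨σ.symm ⟨σ z + 1, by have := (σ x).2; omega⟩, by simp⟩
        have hyx : y ≠ x := by rintro rfl; omega
        have hyz : y ≠ z := by rintro rfl; omega
        have hyz' : y < z → TransGen R y z := fun h => ih 0 hpos y z h hy
        have hxy' : x < y → TransGen R x y := fun h => ih (d - 1) (by omega) x y h (by omega)
        rcases lt_or_gt_of_ne hyx with h₁ | h₁
        · refine (transGen_between hstep (hyz' (h₁.trans hxz)) (Or.inl ⟨h₁, hxz⟩)).resolve_left ?_
          intro hc
          have := Fin.lt_def.mp (hRσ _ _ hc)
          omega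
        · rcases lt_or_gt_of_ne hyz with h₂ | h₂
          · exact (hxy' h₁).trans (hyz' h₂)
          · refine (transGen_between hstep (hxy' h₁) (Or.inl ⟨hxz, h₂⟩)).resolve_right ?_
            intro hc
            have := Fin.lt_def.mp (hRσ _ _ hc)
            omega
  intro x z hxz hlt
  have hlt' := Fin.lt_def.mp hlt
  exact hRτ _ _ (forced (σ x - σ z - 1) x z hxz (by omega))

theorem Agree.invLE_of_locallyMaximal {G : V → V → Prop} (hG : IsSpanned G) {σ τ : V ≃ Fin n}
    (h : Agree G σ τ)
    (hσ : ∀ x z, x < z → (σ z : ℕ) = σ x + 1 → G x z) : InvLE τ σ := by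
  rw [← invLE_dual]
  exact Agree.invLE_of_locallyMinimal hG.dual (fun x z hg => h _ _ hg)
    fun x z hxz he => hG.symm _ _ (hσ (OrderDual.ofDual z) (OrderDual.ofDual x) hxz he)

/-- If the inversions of `σ` are properly contained in those of `τ`, then some pair of consecutive
values of `σ` is inverted in `τ` but not in `σ`. -/
theorem InvLE.exists_step {σ τ : V ≃ Fin n} (h : InvLE σ τ) (hne : σ ≠ τ) :
    ∃ i : Fin (n - 1), σ.symm (lo i) < σ.symm (hi i) ∧
      τ (σ.symm (hi i)) < τ (σ.symm (lo i)) := by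
  by_contra! hcon
  have hasc : ∀ i : Fin (n - 1), τ (σ.symm (lo i)) < τ (σ.symm (hi i)) := by
    intro i
    have hlh : lo i ≠ hi i := by simp [lo, hi, Fin.ext_iff]
    rcases lt_or_gt_of_ne (σ.symm.injective.ne hlh) with hlt | hlt
    · exact lt_of_le_of_ne (hcon i hlt) (τ.injective.ne hlt.ne)
    · exact h _ _ hlt (by simp [lo, hi, Fin.lt_def])
  apply hne
  cases n with
  | zero => ext x; exact (σ x).elim0
  | succ m =>
    have hmono : StrictMono fun x => τ (σ.symm x) :=
      Fin.strictMono_iff_lt_succ.mpr fun i => hasc i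
    have hid : (hmono.orderIsoOfSurjective _ (τ.surjective.comp σ.symm.surjective)) =
      OrderIso.refl _ := Subsingleton.elim _ _
    ext x
    have hx : τ (σ.symm (σ x)) = σ x := congrArg (fun f => f (σ x)) hid
    rw [← hx, Equiv.symm_apply_apply]

theorem InvLE.antisymm {σ τ : V ≃ Fin n} (h : InvLE σ τ) (h' : InvLE τ σ) : σ = τ := by
  by_contra hne
  obtain ⟨i, hlt, hτ⟩ := h.exists_step hne
  have := h' _ _ hlt hτ
  simp [lo, hi, Fin.lt_def] at this

/-- A set `D` of pairs `x < z` is the inversion set of a bijection as soon as `D` and its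
complement are transitive. The bijection sends `x` to its rank for the linear order obtained from
that of `V` by reversing the pairs in `D`. -/
theorem exists_equiv_of_inversions [Fintype V] (hV : Fintype.card V = n) (D : V → V → Prop)
    (hlt : ∀ x z, D x z → x < z) (htrans : ∀ x y z, D x y → D y z → D x z)
    (hco : ∀ x y z, x < y → y < z → D x z → D x y ∨ D y z) :
    ∃ ρ : V ≃ Fin n, ∀ x z, x < z → (ρ z < ρ x ↔ D x z) := by
  classical
  -- The order of `V` with the pairs in `D` reversed.
  let r : V → V → Prop := fun x z => (x < z ∧ ¬ D x z) ∨ D z x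
  have rtrans : ∀ x y z, r x y → r y z → r x z := by
    rintro x y z (⟨h₁, h₂⟩ | h₁) (⟨h₃, h₄⟩ | h₃)
    · exact Or.inl ⟨h₁.trans h₃, fun h => (hco _ _ _ h₁ h₃ h).elim h₂ h₄⟩
    · rcases lt_trichotomy x z with h | rfl | h
      · exact Or.inl ⟨h, fun hd => h₂ (htrans _ _ _ hd h₃)⟩
      · exact absurd h₃ h₂
      · exact Or.inr ((hco _ _ _ h h₁ h₃).resolve_right h₂)
    · rcases lt_trichotomy x z with h | rfl | h
      · exact Or.inl ⟨h, fun hd => h₄ (htrans _ _ _ h₁ hd)⟩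
      · exact absurd h₁ h₄
      · exact Or.inr ((hco _ _ _ h₃ h h₁).resolve_left h₄)
    · exact Or.inr (htrans _ _ _ h₃ h₁)
  have rirrefl : ∀ x, ¬ r x x := by
    rintro x (⟨h, -⟩ | h)
    · exact lt_irrefl _ h
    · exact lt_irrefl _ (hlt _ _ h)
  let f : V → Fin n := fun x => ⟨(Finset.univ.filter fun y => r y x).card, by
    rw [← hV]
    exact Finset.card_lt_univ_of_notMem (x := x) (by simp [rirrefl])⟩
  have hf : ∀ x z, r x z → f x < f z := by
    intro x z h
    rw [Fin.lt_def]
    apply Finset.card_lt_card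
    rw [Finset.ssubset_iff_of_subset]
    · exact ⟨x, by simpa using h, by simp [rirrefl]⟩
    · intro y
      simp only [Finset.mem_filter, Finset.mem_univ, true_and]
      exact fun hy => rtrans _ _ _ hy h
  have htot : ∀ x z, x < z → r x z ∨ r z x := fun x z h => by
    by_cases hd : D x z
    · exact Or.inr (Or.inr hd)
    · exact Or.inl (Or.inl ⟨h, hd⟩)
  have hinj : Function.Injective f := by
    intro x z hxz
    by_contra hne
    have : r x z ∨ r z x := by
      rcases lt_or_gt_of_ne hne with h | h
      · exact htot _ _ h
      · exact (htot _ _ h).symm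
    rcases this with h | h
    · exact (hf _ _ h).ne hxz
    · exact (hf _ _ h).ne' hxz
  refine ⟨Equiv.ofBijective f ((Fintype.bijective_iff_injective_and_card f).mpr
    ⟨hinj, by simp [hV]⟩), fun x z hxz => ⟨fun h => ?_, fun h => hf _ _ (Or.inr h)⟩⟩
  by_contra hd
  exact lt_asymm h (hf x z (Or.inl ⟨hxz, hd⟩))

/-- Any two elements have a join: its inversion set is the transitive closure of the union of the
two inversion sets, whose complement is transitive by `transGen_between`. -/
theorem exists_sup [Fintype V] (σ τ : V ≃ Fin n) :
    ∃ ρ : V ≃ Fin n, InvLE σ ρ ∧ InvLE τ ρ ∧ ∀ κ, InvLE σ κ → InvLE τ κ → InvLE ρ κ := by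
  let R : V → V → Prop := fun x z => x < z ∧ (σ z < σ x ∨ τ z < τ x)
  have hlt : ∀ x z, TransGen R x z → x < z := by
    intro x z h
    induction h with
    | single h => exact h.1
    | tail _ h ih => exact ih.trans h.1
  have hstep : ∀ u y v, R u v → Between u y v → TransGen R u y ∨ TransGen R y v := by
    rintro u y v ⟨huv, hinv⟩ hy
    obtain ⟨h₁, h₂⟩ := hy.resolve_right fun h => lt_asymm huv (h.1.trans h.2)
    rcases hinv with h | h
    · rcases lt_or_ge (σ y) (σ u) with h' | h'
      · exact Or.inl (.single ⟨h₁, Or.inl h'⟩)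
      · exact Or.inr (.single ⟨h₂, Or.inl (h.trans_le h')⟩)
    · rcases lt_or_ge (τ y) (τ u) with h' | h'
      · exact Or.inl (.single ⟨h₁, Or.inr h'⟩)
      · exact Or.inr (.single ⟨h₂, Or.inr (h.trans_le h')⟩)
  obtain ⟨ρ, hρ⟩ := exists_equiv_of_inversions (by simpa using Fintype.card_congr σ)
    (TransGen R) hlt (fun _ _ _ => TransGen.trans)
    (fun x y z h₁ h₂ h => transGen_between hstep h (Or.inl ⟨h₁, h₂⟩))
  refine ⟨ρ, fun x z hxz h => (hρ x z hxz).mpr (.single ⟨hxz, Or.inl h⟩),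
    fun x z hxz h => (hρ x z hxz).mpr (.single ⟨hxz, Or.inr h⟩), ?_⟩
  intro κ h₁ h₂ x z hxz h
  have : ∀ x z, TransGen R x z → κ z < κ x := by
    intro x z h
    induction h with
    | single h => exact h.2.elim (h₁ _ _ h.1) (h₂ _ _ h.1)
    | tail _ h ih => exact (h.2.elim (h₁ _ _ h.1) (h₂ _ _ h.1)).trans ih
  exact this _ _ ((hρ x z hxz).mp h)

theorem exists_inf [Fintype V] (σ τ : V ≃ Fin n) :
    ∃ ρ : V ≃ Fin n, InvLE ρ σ ∧ InvLE ρ τ ∧ ∀ κ, InvLE κ σ → InvLE κ τ → InvLE κ ρ := by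
  obtain ⟨ρ, h₁, h₂, h₃⟩ :=
    exists_sup (V := Vᵒᵈ) (OrderDual.ofDual.trans σ) (OrderDual.ofDual.trans τ)
  refine ⟨OrderDual.toDual.trans ρ, invLE_dual.mp h₁, invLE_dual.mp h₂, fun κ hσ hτ => ?_⟩
  exact invLE_dual.mp (h₃ (OrderDual.ofDual.trans κ) (invLE_dual.mpr hσ) (invLE_dual.mpr hτ))

end Classes

/-! ### Inversions, length and the left weak order -/

section Length

variable {n : ℕ}

theorem lo_lt_hi (i : Fin (n - 1)) : lo i < hi i := by simp [lo, hi, Fin.lt_def]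

/-- An adjacent transposition preserves every strict inequality except the one between the two
letters it exchanges. -/
theorem adjSwap_lt_adjSwap {i : Fin (n - 1)} {a b : Fin n} (h : ¬ (a = lo i ∧ b = hi i))
    (hab : a < b) : adjSwap i a < adjSwap i b := by
  unfold adjSwap
  simp only [Equiv.swap_apply_def, lo, hi, Fin.ext_iff, Fin.lt_def] at *
  split_ifs <;> first | omega | (simp only at *; omega)

theorem adjSwap_mul_adjSwap_mul (i : Fin (n - 1)) (σ : Equiv.Perm (Fin n)) :
    adjSwap i * (adjSwap i * σ) = σ := by
  rw [← mul_assoc, adjSwap, Equiv.swap_mul_self, one_mul]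

/-- Exchanging the values `i` and `i + 1` of `σ`, when they occur in this order, creates exactly
one inversion. -/
theorem adjSwap_mul_inversion {i : Fin (n - 1)} {σ : Equiv.Perm (Fin n)}
    (h : σ.symm (lo i) < σ.symm (hi i)) {x z : Fin n} (hxz : x < z) :
    (adjSwap i * σ) z < (adjSwap i * σ) x ↔
      σ z < σ x ∨ (x = σ.symm (lo i) ∧ z = σ.symm (hi i)) := by
  simp only [Equiv.Perm.mul_apply, Equiv.eq_symm_apply]
  constructor
  · intro hlt
    by_contra! hcon
    have hne : σ x ≠ σ z := σ.injective.ne hxz.ne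
    exact lt_asymm hlt (adjSwap_lt_adjSwap (i := i) (fun hc => hcon.2 hc.1 hc.2)
      (lt_of_le_of_ne hcon.1 hne))
  · rintro (hlt | ⟨hx, hz⟩)
    · refine adjSwap_lt_adjSwap ?_ hlt
      rintro ⟨hz, hx⟩
      rw [← hz, ← hx, Equiv.symm_apply_apply, Equiv.symm_apply_apply] at h
      exact lt_asymm h hxz
    · rw [hx, hz, adjSwap, Equiv.swap_apply_left, Equiv.swap_apply_right]
      exact lo_lt_hi i

theorem invLE_adjSwap_mul {i : Fin (n - 1)} {σ : Equiv.Perm (Fin n)}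
    (h : σ.symm (lo i) < σ.symm (hi i)) : InvLE σ (adjSwap i * σ) :=
  fun _ _ hxz hlt => (adjSwap_mul_inversion h hxz).mpr (Or.inl hlt)

/-- The inversions of a permutation, as pairs of positions. -/
def invSet (σ : Equiv.Perm (Fin n)) : Finset (Fin n × Fin n) :=
  Finset.univ.filter fun p => p.1 < p.2 ∧ σ p.2 < σ p.1

theorem mem_invSet {σ : Equiv.Perm (Fin n)} {p : Fin n × Fin n} :
    p ∈ invSet σ ↔ p.1 < p.2 ∧ σ p.2 < σ p.1 := by simp [invSet]

/-- The number of inversions of a permutation; it is the length, see `len_eq_invCount`. -/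
def invCount (σ : Equiv.Perm (Fin n)) : ℕ := (invSet σ).card

theorem invLE_iff_subset {σ τ : Equiv.Perm (Fin n)} : InvLE σ τ ↔ invSet σ ⊆ invSet τ := by
  constructor
  · intro h p hp
    rw [mem_invSet] at *
    exact ⟨hp.1, h _ _ hp.1 hp.2⟩
  · intro h x z hxz hlt
    exact (mem_invSet.mp (h (mem_invSet (p := (x, z)).mpr ⟨hxz, hlt⟩))).2

theorem InvLE.invCount_le {σ τ : Equiv.Perm (Fin n)} (h : InvLE σ τ) :
    invCount σ ≤ invCount τ := Finset.card_le_card (invLE_iff_subset.mp h)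

theorem invCount_adjSwap_mul {i : Fin (n - 1)} {σ : Equiv.Perm (Fin n)}
    (h : σ.symm (lo i) < σ.symm (hi i)) : invCount (adjSwap i * σ) = invCount σ + 1 := by
  have hmem : (σ.symm (lo i), σ.symm (hi i)) ∉ invSet σ := by
    simp [mem_invSet, (lo_lt_hi i).le]
  rw [invCount, invCount, ← Finset.card_insert_of_notMem hmem]
  congr 1
  ext ⟨x, z⟩
  rw [Finset.mem_insert, mem_invSet, mem_invSet, Prod.mk.injEq]
  constructor
  · rintro ⟨hxz, hlt⟩
    exact ((adjSwap_mul_inversion h hxz).mp hlt).symm.imp_right fun hlt => ⟨hxz, hlt⟩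
  · rintro (⟨rfl, rfl⟩ | ⟨hxz, hlt⟩)
    · exact ⟨h, (adjSwap_mul_inversion h h).mpr (Or.inr ⟨rfl, rfl⟩)⟩
    · exact ⟨hxz, (adjSwap_mul_inversion h hxz).mpr (Or.inl hlt)⟩

theorem ascent_adjSwap_mul {i : Fin (n - 1)} {σ : Equiv.Perm (Fin n)}
    (h : ¬ σ.symm (lo i) < σ.symm (hi i)) :
    (adjSwap i * σ).symm (lo i) < (adjSwap i * σ).symm (hi i) := by
  have h₁ : (adjSwap i * σ).symm (lo i) = σ.symm (hi i) := by
    rw [Equiv.symm_apply_eq, Equiv.Perm.mul_apply, Equiv.apply_symm_apply, adjSwap,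
      Equiv.swap_apply_right]
  have h₂ : (adjSwap i * σ).symm (hi i) = σ.symm (lo i) := by
    rw [Equiv.symm_apply_eq, Equiv.Perm.mul_apply, Equiv.apply_symm_apply, adjSwap,
      Equiv.swap_apply_left]
  rw [h₁, h₂]
  exact lt_of_le_of_ne (not_lt.mp h) (σ.symm.injective.ne (lo_lt_hi i).ne')

theorem invCount_adjSwap_mul_of_not {i : Fin (n - 1)} {σ : Equiv.Perm (Fin n)}
    (h : ¬ σ.symm (lo i) < σ.symm (hi i)) : invCount (adjSwap i * σ) + 1 = invCount σ := by
  have := invCount_adjSwap_mul (ascent_adjSwap_mul h)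
  rw [adjSwap_mul_adjSwap_mul] at this
  exact this.symm

theorem wordProd_cons (i : Fin (n - 1)) (w : List (Fin (n - 1))) :
    wordProd (i :: w) = adjSwap i * wordProd w := by simp [wordProd]

theorem invCount_wordProd_mul_le (w : List (Fin (n - 1))) (σ : Equiv.Perm (Fin n)) :
    invCount (wordProd w * σ) ≤ w.length + invCount σ := by
  induction w with
  | nil => simp [wordProd]
  | cons i w ih =>
    rw [wordProd_cons, mul_assoc, List.length_cons]
    by_cases h : (wordProd w * σ).symm (lo i) < (wordProd w * σ).symm (hi i)
    · rw [invCount_adjSwap_mul h]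
      omega
    · have := invCount_adjSwap_mul_of_not h
      omega

theorem InvLE.exists_word {σ τ : Equiv.Perm (Fin n)} (h : InvLE σ τ) :
    ∃ w : List (Fin (n - 1)), wordProd w * σ = τ ∧ w.length + invCount σ = invCount τ := by
  obtain ⟨d, hd⟩ := Nat.exists_eq_add_of_le h.invCount_le
  induction d generalizing σ with
  | zero =>
    have : invSet σ = invSet τ := Finset.eq_of_subset_of_card_le (invLE_iff_subset.mp h) hd.le
    exact ⟨[], by simpa [wordProd] using h.antisymm (invLE_iff_subset.mpr this.ge),
      by simpa using hd.symm⟩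
  | succ d ih =>
    have hne : σ ≠ τ := by rintro rfl; omega
    obtain ⟨i, hasc, hτ⟩ := h.exists_step hne
    have hle : InvLE (adjSwap i * σ) τ := fun x z hxz hlt => by
      rcases (adjSwap_mul_inversion hasc hxz).mp hlt with hlt | ⟨rfl, rfl⟩
      · exact h _ _ hxz hlt
      · exact hτ
    have hc := invCount_adjSwap_mul hasc
    obtain ⟨w, hw, hlen⟩ := ih hle (by omega)
    exact ⟨w ++ [i], by simpa [wordProd, mul_assoc] using hw, by simp; omega⟩

theorem invCount_one : invCount (1 : Equiv.Perm (Fin n)) = 0 := by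
  rw [invCount, Finset.card_eq_zero, Finset.eq_empty_iff_forall_notMem]
  intro p hp
  rw [mem_invSet] at hp
  exact lt_asymm hp.1 hp.2

theorem IsReducedWord.length_eq {w : List (Fin (n - 1))} {σ : Equiv.Perm (Fin n)}
    (h : IsReducedWord w σ) : w.length = invCount σ := by
  apply le_antisymm
  · have h₁ : InvLE (1 : Equiv.Perm (Fin n)) σ := fun x z hxz hlt => absurd hxz (lt_asymm hlt)
    obtain ⟨v, hv, hlen⟩ := h₁.exists_word
    rw [mul_one] at hv
    rw [invCount_one] at hlen
    exact (h.2 v hv).trans hlen.le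
  · have := invCount_wordProd_mul_le w 1
    rwa [mul_one, h.1, invCount_one] at this

theorem reducedWord_spec (σ : Equiv.Perm (Fin n)) : IsReducedWord (reducedWord σ) σ :=
  (exists_reducedWord σ).choose_spec

theorem len_eq_invCount (σ : Equiv.Perm (Fin n)) : len σ = invCount σ :=
  (reducedWord_spec σ).length_eq

/-- If multiplication by a word adds as many inversions as the word has letters, then each letter
adds one, so that no inversion is lost on the way. -/
theorem invLE_wordProd_mul {w : List (Fin (n - 1))} {σ : Equiv.Perm (Fin n)}
    (h : w.length + invCount σ ≤ invCount (wordProd w * σ)) : InvLE σ (wordProd w * σ) := by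
  induction w with
  | nil => simpa [wordProd] using InvLE.refl σ
  | cons i w ih =>
    rw [wordProd_cons, mul_assoc, List.length_cons] at *
    have hle := invCount_wordProd_mul_le w σ
    have hasc : (wordProd w * σ).symm (lo i) < (wordProd w * σ).symm (hi i) := by
      by_contra hcon
      have := invCount_adjSwap_mul_of_not hcon
      omega
    rw [invCount_adjSwap_mul hasc] at h
    exact (ih (by omega)).trans (invLE_adjSwap_mul hasc)

theorem weakLE_iff_invLE {σ τ : Equiv.Perm (Fin n)} : WeakLE σ τ ↔ InvLE σ τ := by
  constructor
  · intro h
    induction h with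
    | refl => exact InvLE.refl σ
    | tail _ h ih =>
      obtain ⟨i, rfl, hlen⟩ := h
      refine ih.trans (invLE_adjSwap_mul ?_)
      by_contra hcon
      have := invCount_adjSwap_mul_of_not hcon
      rw [len_eq_invCount, len_eq_invCount] at hlen
      omega
  · intro h
    obtain ⟨w, rfl, hlen⟩ := h.exists_word
    clear h
    induction w with
    | nil => exact (show wordProd [] * σ = σ by simp [wordProd]) ▸ ReflTransGen.refl
    | cons i w ih =>
      rw [wordProd_cons, mul_assoc, List.length_cons] at *
      have hle := invCount_wordProd_mul_le w σ
      have hasc : (wordProd w * σ).symm (lo i) < (wordProd w * σ).symm (hi i) := by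
        by_contra hcon
        have := invCount_adjSwap_mul_of_not hcon
        omega
      have hc := invCount_adjSwap_mul hasc
      refine ReflTransGen.tail (ih (by omega)) ⟨i, rfl, ?_⟩
      rw [len_eq_invCount, len_eq_invCount, hc]

end Length

/-! ### The reading order of the cells -/

section Reading

variable {n : ℕ}

/-- The cells of column `j`, from top to bottom. -/
def columnCells (α : Composition n) (j : ℕ) : List (Cell α) :=
  (List.finRange α.length).filterMap fun i =>
    if h : j < α.blocksFun i then some ⟨i, ⟨j, h⟩⟩ else none

/-- All cells in the order in which the column word reads them. -/
def reading (α : Composition n) : List (Cell α) :=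
  (List.range n).flatMap (columnCells α)

variable {α : Composition n}

/-- The reading order on cells: columns from left to right, each from top to bottom. -/
def Precedes (c d : Cell α) : Prop := c.2.1 < d.2.1 ∨ (c.2.1 = d.2.1 ∧ c.1 < d.1)

theorem Precedes.asymm {c d : Cell α} (h : Precedes c d) (h' : Precedes d c) : False := by
  unfold Precedes at *
  simp only [Fin.lt_def] at *
  omega

theorem mem_columnCells {j : ℕ} {c : Cell α} : c ∈ columnCells α j ↔ c.2.1 = j := by
  simp only [columnCells, List.mem_filterMap, List.mem_finRange, true_and]
  constructor
  · rintro ⟨i, hi⟩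
    split_ifs at hi with h
    rw [← Option.some.inj hi]
  · rintro rfl
    exact ⟨c.1, by rw [dif_pos c.2.2]⟩

theorem mem_reading (c : Cell α) : c ∈ reading α := by
  simp only [reading, List.mem_flatMap, List.mem_range, mem_columnCells]
  exact ⟨_, lt_of_lt_of_le c.2.2 (α.blocksFun_le _), rfl⟩

theorem pairwise_columnCells (j : ℕ) : (columnCells α j).Pairwise Precedes := by
  rw [columnCells, List.pairwise_filterMap]
  refine (List.pairwise_lt_finRange _).imp fun {i i'} hii' c hc d hd => ?_
  split_ifs at hc with h
  split_ifs at hd with h'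
  rw [← Option.some.inj hc, ← Option.some.inj hd]
  exact Or.inr ⟨rfl, hii'⟩

theorem pairwise_reading : (reading α).Pairwise Precedes := by
  rw [reading, List.pairwise_flatMap]
  refine ⟨fun j _ => pairwise_columnCells j, List.pairwise_lt_range.imp fun hjk c hc d hd => ?_⟩
  rw [mem_columnCells] at hc hd
  exact Or.inl (by omega)

theorem nodup_reading : (reading α).Nodup :=
  pairwise_reading.imp fun h he => by subst he; exact h.asymm h

theorem columnWord_eq_map (T : Filling α) (j : ℕ) :
    columnWord T j = (columnCells α j).map T := by
  rw [columnWord, columnCells, List.map_filterMap]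
  congr 1
  funext i
  split_ifs <;> rfl

theorem colWord_eq_map (T : Filling α) : colWord T = (reading α).map T := by
  rw [colWord, reading, List.map_flatMap]
  congr 1
  funext j
  exact columnWord_eq_map T j

theorem length_reading : (reading α).length = n := by
  have h : Fintype.card (Cell α) = n := by simp [Composition.sum_blocksFun]
  refine Eq.trans ?_ h
  simpa using Fintype.card_congr
    (List.Nodup.getEquivOfForallMemList _ (nodup_reading (α := α)) mem_reading)

/-- The cell read in position `p` of the column word. -/
def cellAt (α : Composition n) : Fin n ≃ Cell α :=
  (finCongr (length_reading (α := α)).symm).trans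
    (List.Nodup.getEquivOfForallMemList _ nodup_reading mem_reading)

theorem col_eq (T : Filling α) : col T = (cellAt α).trans T := by
  ext p
  simp [col, cellAt, colWord_eq_map]

theorem col_apply (T : Filling α) (p : Fin n) : col T p = T (cellAt α p) := by
  rw [col_eq]; rfl

theorem cellAt_col_symm (T : Filling α) (x : Fin n) : cellAt α ((col T).symm x) = T.symm x := by
  rw [col_eq]; simp

theorem precedes_cellAt {p q : Fin n} : Precedes (cellAt α p) (cellAt α q) ↔ p < q := by
  have key : ∀ p q : Fin n, p < q → Precedes (cellAt α p) (cellAt α q) := fun p q h =>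
    List.pairwise_iff_get.mp (pairwise_reading (α := α)) _ _ h
  refine ⟨fun h => ?_, key p q⟩
  rcases lt_trichotomy p q with h' | rfl | h'
  · exact h'
  · exact (h.asymm h).elim
  · exact (h.asymm (key _ _ h')).elim

theorem col_symm_lt {T : Filling α} {x y : Fin n} :
    (col T).symm x < (col T).symm y ↔ Precedes (T.symm x) (T.symm y) := by
  rw [← precedes_cellAt (α := α), cellAt_col_symm, cellAt_col_symm]

theorem col_switch (i : Fin (n - 1)) (T : Filling α) : col (switch i T) = adjSwap i * col T := by
  ext p
  rw [col_apply, Equiv.Perm.mul_apply, col_apply]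
  rfl

theorem col_injective : Function.Injective (col : Filling α → Equiv.Perm (Fin n)) := by
  intro S T h
  ext c
  have := congrArg (fun σ : Equiv.Perm (Fin n) => σ ((cellAt α).symm c)) h
  simp only [col_apply, Equiv.apply_symm_apply] at this
  rw [this]

theorem exists_col_eq (σ : Equiv.Perm (Fin n)) : ∃ T : Filling α, col T = σ :=
  ⟨(cellAt α).symm.trans σ, by ext p; simp [col_apply]⟩

/-- The rank of `T c` within its column is the number of cells of that column whose entry is at most
`T c`. As all words `st T` list these ranks along the same list of cells, they can be compared cell
by cell. -/
theorem st_eq_map (T : Filling α) :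
    st T = (reading α).map fun c => {d : Cell α | d.2.1 = c.2.1 ∧ T d ≤ T c}.ncard := by
  classical
  rw [st, reading, List.map_flatMap]
  congr 1
  funext j
  rw [columnWord_eq_map, standardize, List.map_map]
  refine List.map_congr_left fun c hc => ?_
  rw [mem_columnCells] at hc
  have hnd : (columnCells α j).Nodup :=
    (pairwise_columnCells j).imp fun h he => by subst he; exact h.asymm h
  rw [Function.comp_apply, List.countP_map, List.countP_eq_length_filter,
    ← List.toFinset_card_of_nodup (hnd.filter _), ← Set.ncard_coe_finset]
  congr 1
  ext d
  simp [mem_columnCells, hc]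

theorem st_eq_iff {S T : Filling α} :
    st S = st T ↔ ∀ c d : Cell α, c.2.1 = d.2.1 → (S c < S d ↔ T c < T d) := by
  rw [st_eq_map, st_eq_map, List.map_inj_left]
  constructor
  · intro h c d hcd
    have key : ∀ U : Filling α, U c < U d ↔
        {e : Cell α | e.2.1 = c.2.1 ∧ U e ≤ U c}.ncard <
          {e : Cell α | e.2.1 = d.2.1 ∧ U e ≤ U d}.ncard := by
      intro U
      constructor
      · intro hlt
        apply Set.ncard_lt_ncard _ (Set.toFinite _)
        rw [Set.ssubset_iff_of_subset]
        · exact ⟨d, ⟨rfl, le_rfl⟩, fun hd => hlt.not_ge hd.2⟩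
        · exact fun e he => ⟨he.1.trans hcd, he.2.trans hlt.le⟩
      · intro hlt
        by_contra hcon
        refine hlt.not_ge (Set.ncard_le_ncard ?_ (Set.toFinite _))
        exact fun e he => ⟨he.1.trans hcd.symm, he.2.trans (not_lt.mp hcon)⟩
    rw [key S, key T, h c (mem_reading c), h d (mem_reading d)]
  · intro h c _
    congr 1
    ext d
    refine and_congr_right fun hd => ?_
    rw [← not_lt, ← not_lt, h c d hd.symm]

end Reading

/-! ### Equivalence classes as agreement classes -/

section Edges

variable {n : ℕ} {α : Composition n}

/-- The pairs of cells whose relative order is fixed on an equivalence class: cells in the same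
column, and cells in adjacent columns of which the right one is in a weakly lower row. A cell is
related to itself. -/
def Edge (c d : Cell α) : Prop :=
  c.2.1 = d.2.1 ∨ (d.2.1 = c.2.1 + 1 ∧ c.1 ≤ d.1) ∨ (c.2.1 = d.2.1 + 1 ∧ d.1 ≤ c.1)

/-- A cell read between the two ends of an edge lies in the column of one of them. -/
theorem isSpanned_edge (α : Composition n) :
    IsSpanned fun p q : Fin n => Edge (cellAt α p) (cellAt α q) where
  symm x y h := by
    unfold Edge at *
    rw [eq_comm (a := (cellAt α y).2.1)]
    tauto
  between x y z hxy hyz h := by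
    rw [← precedes_cellAt (α := α)] at hxy hyz
    unfold Edge Precedes at *
    omega

/-- `S` and `T` order the entries of any two cells forming an edge in the same way. -/
def EdgeAgree (S T : Filling α) : Prop := ∀ c d : Cell α, Edge c d → (S c < S d ↔ T c < T d)

theorem edgeAgree_iff_agree {S T : Filling α} : EdgeAgree S T ↔
    Agree (fun p q : Fin n => Edge (cellAt α p) (cellAt α q)) (col S) (col T) := by
  simp only [EdgeAgree, Agree, col_apply]
  constructor
  · exact fun h p q hpq => h _ _ hpq
  · intro h c d hcd
    have := h ((cellAt α).symm c) ((cellAt α).symm d)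
    simp only [Equiv.apply_symm_apply] at this
    exact this hcd

/-- For cells `(i, k)` and `(j, k + 1)` with `i < j`, the triple rule together with the decrease of
the rows says that the second entry is the smaller one if and only if `(i, k + 1)` exists and has a
larger entry than `(j, k + 1)`, a condition on the order within column `k + 1`. -/
theorem IsSRCT.edgeAgree {S T : Filling α} (hS : IsSRCT S) (hT : IsSRCT T) (h : st S = st T) :
    EdgeAgree S T := by
  rw [st_eq_iff] at h
  have row : ∀ U : Filling α, IsSRCT U → ∀ (i : Fin α.length) (k : ℕ) (h₀ : k < α.blocksFun i)
      (h₁ : k + 1 < α.blocksFun i), U ⟨i, k + 1, h₁⟩ < U ⟨i, k, h₀⟩ :=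
    fun U hU i k h₀ h₁ => hU.row_decreasing i ⟨k, h₀⟩ ⟨k + 1, h₁⟩ (Nat.lt_succ_self k)
  have triple : ∀ U : Filling α, IsSRCT U → ∀ (i j : Fin α.length) (k : ℕ)
      (h₀ : k < α.blocksFun i) (h₁ : k + 1 < α.blocksFun j), i < j →
      (U ⟨j, k + 1, h₁⟩ < U ⟨i, k, h₀⟩ ↔
        ∃ h : k + 1 < α.blocksFun i, U ⟨j, k + 1, h₁⟩ < U ⟨i, k + 1, h⟩) :=
    fun U hU i j k h₀ h₁ hij => ⟨hU.triple i j k h₀ h₁ hij,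
      fun ⟨h', hlt⟩ => hlt.trans (row U hU i k h₀ h')⟩
  have adj : ∀ (i j : Fin α.length) (k : ℕ) (h₀ : k < α.blocksFun i)
      (h₁ : k + 1 < α.blocksFun j), i ≤ j →
      (S ⟨j, k + 1, h₁⟩ < S ⟨i, k, h₀⟩ ↔ T ⟨j, k + 1, h₁⟩ < T ⟨i, k, h₀⟩) := by
    intro i j k h₀ h₁ hij
    rcases hij.eq_or_lt with rfl | hlt
    · exact iff_of_true (row S hS _ _ _ _) (row T hT _ _ _ _)
    · rw [triple S hS i j k h₀ h₁ hlt, triple T hT i j k h₀ h₁ hlt]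
      exact exists_congr fun h' => h ⟨j, k + 1, h₁⟩ ⟨i, k + 1, h'⟩ rfl
  rintro ⟨i, k, hk⟩ ⟨j, l, hl⟩ (hc | ⟨hc, hr⟩ | ⟨hc, hr⟩)
  · exact h _ _ hc
  · obtain rfl : l = k + 1 := hc
    have hne : (⟨i, k, hk⟩ : Cell α) ≠ ⟨j, k + 1, hl⟩ := fun he => by
      have := congrArg (fun c : Cell α => c.2.1) he
      simp at this
    rw [← not_iff_not, not_lt, not_lt, (S.injective.ne hne).symm.le_iff_lt,
      (T.injective.ne hne).symm.le_iff_lt]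
    exact adj i j k hk hl hr
  · obtain rfl : k = l + 1 := hc
    exact adj j i l hl hk hr

theorem EdgeAgree.st_eq {S T : Filling α} (h : EdgeAgree S T) : st S = st T :=
  st_eq_iff.mpr fun c d hcd => h c d (Or.inl hcd)

/-- All defining conditions of a standard reverse composition tableau follow from comparisons along
edges. -/
theorem EdgeAgree.isSRCT {S T : Filling α} (h : EdgeAgree S T) (hS : IsSRCT S) : IsSRCT T where
  row_decreasing := by
    have step : ∀ (i : Fin α.length) (k : ℕ) (h₀ : k < α.blocksFun i)
        (h₁ : k + 1 < α.blocksFun i), T ⟨i, k + 1, h₁⟩ < T ⟨i, k, h₀⟩ := fun i k h₀ h₁ =>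
      (h ⟨i, k + 1, h₁⟩ ⟨i, k, h₀⟩ (Or.inr (Or.inr ⟨rfl, le_rfl⟩))).mp
        (hS.row_decreasing i ⟨k, h₀⟩ ⟨k + 1, h₁⟩ (Nat.lt_succ_self k))
    rintro i ⟨k, hk⟩ ⟨l, hl⟩ hkl
    induction l with
    | zero => exact absurd hkl (Nat.not_lt_zero k)
    | succ l ih =>
      rcases Nat.lt_succ_iff_lt_or_eq.mp hkl with hlt | rfl
      · exact (step i l _ hl).trans (ih (by omega) hlt)
      · exact step i k hk hl
  first_column_increasing i j hi hj hij :=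
    (h ⟨i, 0, hi⟩ ⟨j, 0, hj⟩ (Or.inl rfl)).mp (hS.first_column_increasing i j hi hj hij)
  triple i j k hi hj hij hlt := by
    obtain ⟨h', hS'⟩ := hS.triple i j k hi hj hij
      ((h _ _ (Or.inr (Or.inr ⟨rfl, hij.le⟩))).mpr hlt)
    exact ⟨h', (h ⟨j, k + 1, hj⟩ ⟨i, k + 1, h'⟩ (Or.inl rfl)).mp hS'⟩

end Edges

/-! ### The operators on fillings -/

section Flips

variable {n : ℕ} {α : Composition n}

theorem Edge.symm {c d : Cell α} (h : Edge c d) : Edge d c := by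
  unfold Edge at *
  rw [eq_comm (a := d.2.1)]
  tauto

/-- Exchanging consecutive letters affects the relative order of only one pair of cells. -/
theorem edgeAgree_switch {T : Filling α} {i : Fin (n - 1)}
    (h : ¬ Edge (T.symm (lo i)) (T.symm (hi i))) : EdgeAgree T (switch i T) := by
  have key : ∀ c d : Cell α, Edge c d → T c < T d → switch i T c < switch i T d := by
    intro c d hcd hlt
    refine adjSwap_lt_adjSwap ?_ hlt
    rintro ⟨hc, hd⟩
    rw [← hc, ← hd, Equiv.symm_apply_apply, Equiv.symm_apply_apply] at h
    exact h hcd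
  refine fun c d hcd => ⟨key c d hcd, fun hlt => ?_⟩
  by_contra hcon
  rcases (not_lt.mp hcon).eq_or_lt with he | hlt'
  · rw [T.injective he] at hlt
    exact lt_irrefl _ hlt
  · exact lt_asymm hlt (key d c hcd.symm hlt')

theorem Attacking.edge {T : Filling α} {i : Fin (n - 1)} (h : Attacking T i) :
    Edge (T.symm (lo i)) (T.symm (hi i)) := by
  rcases h with h | ⟨hc, hr⟩
  · exact Or.inl h
  · exact Or.inr (Or.inl ⟨hc, Fin.le_def.mpr (Nat.le_of_lt hr)⟩)

theorem flip_eq_switch {T : Filling α} {i : Fin (n - 1)}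
    (hp : Precedes (T.symm (lo i)) (T.symm (hi i)))
    (he : ¬ Edge (T.symm (lo i)) (T.symm (hi i))) : flip i T = some (switch i T) := by
  have hd : IsDescent T i := hp.elim (fun h => h.le) fun h => h.1.le
  rw [flip, if_neg (not_not.mpr hd), if_neg fun ha : Attacking T i => he ha.edge]

theorem invLE_of_flip_eq_some {S T : Filling α} {i : Fin (n - 1)} (h : flip i S = some T) :
    InvLE (col S) (col T) := by
  rw [flip] at h
  split_ifs at h with hd ha
  · obtain rfl := Option.some.inj h
    obtain hd | he := (hd : colOf S (lo i) ≤ colOf S (hi i)).lt_or_eq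
    · rw [col_switch]
      exact invLE_adjSwap_mul (col_symm_lt.mpr (Or.inl hd))
    · exact absurd (Or.inl he) ha
  · obtain rfl := Option.some.inj h
    exact InvLE.refl _

theorem flipWord_cons (i : Fin (n - 1)) (w : List (Fin (n - 1))) (T : Filling α) :
    flipWord (i :: w) T = (flipWord w T).bind (flip i) := rfl

theorem invLE_of_flipWord_eq_some {w : List (Fin (n - 1))} {S T : Filling α}
    (h : flipWord w S = some T) : InvLE (col S) (col T) := by
  induction w generalizing T with
  | nil =>
    obtain rfl : S = T := Option.some.inj h
    exact InvLE.refl _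
  | cons i w ih =>
    rw [flipWord_cons, Option.bind_eq_some_iff] at h
    obtain ⟨U, hU, hT⟩ := h
    exact (ih hU).trans (invLE_of_flip_eq_some hT)

/-- Every word that leads from `col S` to `col T` with additive lengths also leads from `S` to `T`
under the operators `π_i`: the intermediate permutations stay in the class by convexity, so that no
letter of the word exchanges attacking entries. -/
theorem EdgeAgree.flipWord_eq_some {w : List (Fin (n - 1))} {S T : Filling α}
    (h : EdgeAgree S T) (hw : wordProd w * col S = col T)
    (hlen : w.length + invCount (col S) ≤ invCount (col T)) : flipWord w S = some T := by
  induction w generalizing T with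
  | nil =>
    obtain rfl : S = T := col_injective (by simpa [wordProd] using hw)
    rfl
  | cons i w ih =>
    obtain ⟨U, hU⟩ := exists_col_eq (α := α) (wordProd w * col S)
    have hT : col T = adjSwap i * col U := by rw [hU, ← hw, wordProd_cons, mul_assoc]
    have hle := invCount_wordProd_mul_le w (col S)
    rw [← hU] at hle
    rw [List.length_cons] at hlen
    have hasc : (col U).symm (lo i) < (col U).symm (hi i) := by
      by_contra hcon
      have := invCount_adjSwap_mul_of_not hcon
      rw [← hT] at this
      omega
    have hc := invCount_adjSwap_mul hasc
    rw [← hT] at hc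
    have hSU : InvLE (col S) (col U) := hU ▸ invLE_wordProd_mul (by rw [← hU]; omega)
    have hUT : InvLE (col U) (col T) := hT ▸ invLE_adjSwap_mul hasc
    -- `U` lies between `S` and `T` in the weak order, hence belongs to the class.
    have hagree : EdgeAgree S U := edgeAgree_iff_agree.mpr
      (Agree.of_invLE (isSpanned_edge α) (edgeAgree_iff_agree.mp h) hSU hUT)
    have hTU : switch i U = T := col_injective (by rw [col_switch, hT])
    rw [flipWord_cons, ih hagree hU.symm (by omega), Option.bind_some, ← hTU]
    refine flip_eq_switch (col_symm_lt.mp hasc) fun he => ?_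
    -- An edge would have to carry `i` and `i + 1` in the same order in `U` and in `T`.
    have hS := hagree _ _ he
    have hT' := h _ _ he
    rw [hS, ← hTU, switch, Equiv.trans_apply, Equiv.trans_apply, Equiv.apply_symm_apply,
      Equiv.apply_symm_apply, adjSwap, Equiv.swap_apply_left, Equiv.swap_apply_right] at hT'
    exact lt_asymm (lo_lt_hi i) (hT'.mp (lo_lt_hi i))

/-- Within a class, `≼_α` is the left weak order of the column words. The reduced word that defines
`π_σ` may be an arbitrary one, since `EdgeAgree.flipWord_eq_some` applies to all of them. -/
theorem EdgeAgree.flipLE_iff {S T : SRCT α} (h : EdgeAgree S.1 T.1) :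
    FlipLE S T ↔ InvLE (col S.1) (col T.1) := by
  constructor
  · rintro ⟨σ, hσ⟩
    exact invLE_of_flipWord_eq_some hσ
  · intro hle
    refine ⟨col T.1 * (col S.1)⁻¹, ?_⟩
    obtain ⟨v, hv, hlen⟩ := hle.exists_word
    have hred := reducedWord_spec (col T.1 * (col S.1)⁻¹)
    have := hred.2 v (by rw [← hv, mul_inv_cancel_right])
    exact h.flipWord_eq_some (by rw [hred.1, inv_mul_cancel_right]) (by omega)

end Flips

/-! ### Sources and sinks as local extrema -/

section SourceSink

variable {n : ℕ} {α : Composition n}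

theorem IsSource.edge {T : SRCT α} (h : IsSource T) {x z : Fin n} (hxz : x < z)
    (he : (col T.1 x : ℕ) = col T.1 z + 1) : Edge (cellAt α x) (cellAt α z) := by
  let i : Fin (n - 1) := ⟨col T.1 z, by have := (col T.1 x).2; omega⟩
  have hz : T.1.symm (lo i) = cellAt α z := by
    rw [Equiv.symm_apply_eq, ← col_apply]; rfl
  have hx : T.1.symm (hi i) = cellAt α x := by
    rw [Equiv.symm_apply_eq, ← col_apply, Fin.ext_iff, he]; rfl
  rw [← precedes_cellAt (α := α)] at hxz
  have hi := h i
  unfold IsDescent rowOf colOf at hi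
  rw [hz, hx] at hi
  unfold Edge
  rcases hxz with hlt | hlt
  · obtain ⟨hr, hc⟩ := hi (not_le.mpr hlt)
    exact Or.inr (Or.inl ⟨hc.symm, Fin.le_def.mpr hr.le⟩)
  · exact Or.inl hlt.1

theorem IsSink.edge {T : SRCT α} (h : IsSink T) {x z : Fin n} (hxz : x < z)
    (he : (col T.1 z : ℕ) = col T.1 x + 1) : Edge (cellAt α x) (cellAt α z) := by
  let i : Fin (n - 1) := ⟨col T.1 x, by have := (col T.1 z).2; omega⟩
  have hx : T.1.symm (lo i) = cellAt α x := by
    rw [Equiv.symm_apply_eq, ← col_apply]; rfl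
  have hz : T.1.symm (hi i) = cellAt α z := by
    rw [Equiv.symm_apply_eq, ← col_apply, Fin.ext_iff, he]; rfl
  rw [← precedes_cellAt (α := α)] at hxz
  rw [← hx, ← hz] at hxz ⊢
  exact (h i (hxz.elim (fun h => h.le) fun h => h.1.le)).edge

/-- If every inverted pair of consecutive letters occupies an edge, then the triple rule forces the
two cells into the same row: otherwise the cell to the right of `i + 1` would hold a letter strictly
between `i` and `i + 1`. -/
theorem isSource_of_edge {T : SRCT α} (h : ∀ i : Fin (n - 1),
    Precedes (T.1.symm (hi i)) (T.1.symm (lo i)) → Edge (T.1.symm (lo i)) (T.1.symm (hi i))) :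
    IsSource T := by
  intro i hd
  have hlt : (T.1.symm (hi i)).2.1 < (T.1.symm (lo i)).2.1 := not_le.mp hd
  have he := h i (Or.inl hlt)
  have hhi := T.1.apply_symm_apply (hi i)
  have hlo := T.1.apply_symm_apply (lo i)
  unfold rowOf colOf
  generalize T.1.symm (hi i) = c at *
  generalize T.1.symm (lo i) = d at *
  obtain ⟨hc, hr⟩ : d.2.1 = c.2.1 + 1 ∧ c.1 ≤ d.1 := by
    unfold Edge at he
    omega
  refine ⟨?_, hc.symm⟩
  by_contra hne
  have hr' : c.1 < d.1 := lt_of_le_of_ne hr fun h => hne (congrArg Fin.val h)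
  obtain ⟨r, k, hk⟩ := c
  obtain ⟨r', l, hl⟩ := d
  obtain rfl : l = k + 1 := hc
  have hval : T.1 ⟨r', k + 1, hl⟩ < T.1 ⟨r, k, hk⟩ := by
    rw [hhi, hlo]; exact lo_lt_hi i
  obtain ⟨h', hlt'⟩ := T.2.triple r r' k hk hl hr' hval
  have hrow := T.2.row_decreasing r ⟨k, hk⟩ ⟨k + 1, h'⟩ (Nat.lt_succ_self k)
  rw [hlo, Fin.lt_def] at hlt'
  rw [hhi, Fin.lt_def] at hrow
  simp only [lo, hi] at hlt' hrow
  omega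

/-- If every non-inverted pair of consecutive letters occupies an edge, then it is attacking: the
remaining kind of edge, two neighbours in a row, is excluded by the decrease of the rows. -/
theorem isSink_of_edge {T : SRCT α} (h : ∀ i : Fin (n - 1),
    Precedes (T.1.symm (lo i)) (T.1.symm (hi i)) → Edge (T.1.symm (lo i)) (T.1.symm (hi i))) :
    IsSink T := by
  intro i hd
  rcases (show colOf T.1 (lo i) ≤ colOf T.1 (hi i) from hd).lt_or_eq with hlt | heq
  · right
    have he := h i (Or.inl hlt)
    have hhi := T.1.apply_symm_apply (hi i)
    have hlo := T.1.apply_symm_apply (lo i)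
    unfold rowOf colOf at *
    generalize T.1.symm (hi i) = d at *
    generalize T.1.symm (lo i) = c at *
    obtain ⟨hc, hr⟩ : d.2.1 = c.2.1 + 1 ∧ c.1 ≤ d.1 := by
      unfold Edge at he
      omega
    refine ⟨hc, Fin.lt_def.mp (lt_of_le_of_ne hr fun hrow => ?_)⟩
    obtain ⟨r, k, hk⟩ := c
    obtain ⟨r', l, hl⟩ := d
    obtain rfl : r = r' := hrow
    have := T.2.row_decreasing r ⟨k, hk⟩ ⟨l, hl⟩ hlt
    rw [hlo, hhi] at this
    exact lt_asymm this (lo_lt_hi i)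
  · exact Or.inl heq

end SourceSink

/-! ### The lattice structure of a class -/

section ClassOrder

variable {n : ℕ} {α : Composition n} {E : Set (SRCT α)}

theorem edgeAgree_of_mem_class (hE : E ∈ (stSetoid α).classes) {S T : SRCT α} (hS : S ∈ E)
    (hT : T ∈ E) : EdgeAgree S.1 T.1 := by
  obtain ⟨U, rfl⟩ := hE
  exact S.2.edgeAgree T.2 (Eq.trans (show st S.1 = st U.1 from hS) (Eq.symm hT))

theorem EdgeAgree.exists_mem_class (hE : E ∈ (stSetoid α).classes) {S : SRCT α} {T : Filling α}
    (h : EdgeAgree S.1 T) (hS : S ∈ E) : ∃ hT : IsSRCT T, (⟨T, hT⟩ : SRCT α) ∈ E := by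
  obtain ⟨U, rfl⟩ := hE
  exact ⟨h.isSRCT S.2, Eq.trans (Eq.symm h.st_eq) (show st S.1 = st U.1 from hS)⟩

theorem exists_mem_class_of_invLE (hE : E ∈ (stSetoid α).classes) {S T : SRCT α} (hS : S ∈ E)
    (hT : T ∈ E) {σ : Equiv.Perm (Fin n)} (h₁ : InvLE (col S.1) σ) (h₂ : InvLE σ (col T.1)) :
    ∃ U ∈ E, col U.1 = σ := by
  obtain ⟨U, rfl⟩ := exists_col_eq (α := α) σ
  have h : EdgeAgree S.1 U := edgeAgree_iff_agree.mpr (Agree.of_invLE (isSpanned_edge α)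
    (edgeAgree_iff_agree.mp (edgeAgree_of_mem_class hE hS hT)) h₁ h₂)
  obtain ⟨hU, hUE⟩ := h.exists_mem_class hE hS
  exact ⟨⟨U, hU⟩, hUE, rfl⟩

theorem srct_col_injective {S T : SRCT α} (h : col S.1 = col T.1) : S = T :=
  Subtype.ext (col_injective h)

theorem IsSource.invLE (hE : E ∈ (stSetoid α).classes) {S T : SRCT α} (h : IsSource S)
    (hS : S ∈ E) (hT : T ∈ E) : InvLE (col S.1) (col T.1) :=
  (edgeAgree_iff_agree.mp (edgeAgree_of_mem_class hE hS hT)).invLE_of_locallyMinimal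
    (isSpanned_edge α) fun _ _ => h.edge

theorem IsSink.invLE (hE : E ∈ (stSetoid α).classes) {S T : SRCT α} (h : IsSink S)
    (hS : S ∈ E) (hT : T ∈ E) : InvLE (col T.1) (col S.1) :=
  (edgeAgree_iff_agree.mp (edgeAgree_of_mem_class hE hS hT)).invLE_of_locallyMaximal
    (isSpanned_edge α) fun _ _ => h.edge

instance : Finite (SRCT α) := inferInstanceAs (Finite {T : Filling α // IsSRCT T})

theorem nonempty_of_mem_class (hE : E ∈ (stSetoid α).classes) : E.Nonempty := by
  obtain ⟨U, rfl⟩ := hE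
  exact ⟨U, rfl⟩

/-- A tableau of the class with the fewest inversions is a source: an inverted pair of consecutive
letters that is not an edge could be exchanged without leaving the class. -/
theorem exists_isSource (hE : E ∈ (stSetoid α).classes) : ∃ T ∈ E, IsSource T := by
  obtain ⟨T, hT, hmin⟩ := Set.exists_min_image E (fun T => invCount (col T.1)) (Set.toFinite E)
    (nonempty_of_mem_class hE)
  refine ⟨T, hT, isSource_of_edge fun i hp => ?_⟩
  by_contra he
  obtain ⟨hU, hUE⟩ := (edgeAgree_switch he).exists_mem_class hE hT
  have h₁ := hmin _ hUE
  have h₂ := invCount_adjSwap_mul_of_not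
    (fun h => hp.asymm (col_symm_lt.mp h) : ¬ (col T.1).symm (lo i) < (col T.1).symm (hi i))
  rw [← col_switch] at h₂
  dsimp only at h₁
  exact Nat.not_succ_le_self _ (h₂.trans_le h₁)

theorem exists_isSink (hE : E ∈ (stSetoid α).classes) : ∃ T ∈ E, IsSink T := by
  obtain ⟨T, hT, hmax⟩ := Set.exists_max_image E (fun T => invCount (col T.1)) (Set.toFinite E)
    (nonempty_of_mem_class hE)
  refine ⟨T, hT, isSink_of_edge fun i hp => ?_⟩
  by_contra he
  obtain ⟨hU, hUE⟩ := (edgeAgree_switch he).exists_mem_class hE hT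
  have h₁ := hmax _ hUE
  have h₂ := invCount_adjSwap_mul (col_symm_lt.mpr hp)
  rw [← col_switch] at h₂
  dsimp only at h₁
  exact Nat.not_succ_le_self _ (h₂.symm.trans_le h₁)

theorem exists_sup_mem_class (hE : E ∈ (stSetoid α).classes) (S T : E) :
    ∃ U : E, InvLE (col S.1.1) (col U.1.1) ∧ InvLE (col T.1.1) (col U.1.1) ∧
      ∀ W : E, InvLE (col S.1.1) (col W.1.1) → InvLE (col T.1.1) (col W.1.1) →
        InvLE (col U.1.1) (col W.1.1) := by
  obtain ⟨Z, hZ, hsink⟩ := exists_isSink hE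
  obtain ⟨ρ, h₁, h₂, h₃⟩ := exists_sup (col S.1.1) (col T.1.1)
  obtain ⟨U, hU, rfl⟩ := exists_mem_class_of_invLE hE S.2 hZ h₁
    (h₃ _ (hsink.invLE hE hZ S.2) (hsink.invLE hE hZ T.2))
  exact ⟨⟨U, hU⟩, h₁, h₂, fun W => h₃ _⟩

theorem exists_inf_mem_class (hE : E ∈ (stSetoid α).classes) (S T : E) :
    ∃ U : E, InvLE (col U.1.1) (col S.1.1) ∧ InvLE (col U.1.1) (col T.1.1) ∧
      ∀ W : E, InvLE (col W.1.1) (col S.1.1) → InvLE (col W.1.1) (col T.1.1) →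
        InvLE (col W.1.1) (col U.1.1) := by
  obtain ⟨Z, hZ, hsource⟩ := exists_isSource hE
  obtain ⟨ρ, h₁, h₂, h₃⟩ := exists_inf (col S.1.1) (col T.1.1)
  obtain ⟨U, hU, rfl⟩ := exists_mem_class_of_invLE hE hZ S.2
    (h₃ _ (hsource.invLE hE hZ S.2) (hsource.invLE hE hZ T.2)) h₁
  exact ⟨⟨U, hU⟩, h₁, h₂, fun W => h₃ _⟩

/-- The lattice structure on a class. The join and the meet in the weak order of two elements of
the class lie between the source and the sink, hence belong to the class. -/
noncomputable abbrev classLattice (hE : E ∈ (stSetoid α).classes) : Lattice E where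
  le S T := InvLE (col S.1.1) (col T.1.1)
  le_refl _ := InvLE.refl _
  le_trans _ _ _ := InvLE.trans
  le_antisymm _ _ h h' := Subtype.ext (srct_col_injective (h.antisymm h'))
  sup S T := (exists_sup_mem_class hE S T).choose
  le_sup_left S T := (exists_sup_mem_class hE S T).choose_spec.1
  le_sup_right S T := (exists_sup_mem_class hE S T).choose_spec.2.1
  sup_le S T W := (exists_sup_mem_class hE S T).choose_spec.2.2 W
  inf S T := (exists_inf_mem_class hE S T).choose
  inf_le_left S T := (exists_inf_mem_class hE S T).choose_spec.1
  inf_le_right S T := (exists_inf_mem_class hE S T).choose_spec.2.1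
  le_inf W S T := (exists_inf_mem_class hE S T).choose_spec.2.2 W

theorem invCount_lt_of_invLE {S T : SRCT α} (h : InvLE (col S.1) (col T.1)) (hne : S ≠ T) :
    invCount (col S.1) < invCount (col T.1) := by
  refine lt_of_le_of_ne h.invCount_le fun he => hne (srct_col_injective (h.antisymm ?_))
  exact invLE_iff_subset.mpr
    (Finset.eq_of_subset_of_card_le (invLE_iff_subset.mp h) (Eq.ge he)).ge

/-- Below any larger element of the class there is one with exactly one more inversion than `S`; so
covers in the class are covers in the weak order. -/
theorem exists_cover_in_class (hE : E ∈ (stSetoid α).classes) {S T : SRCT α} (hS : S ∈ E)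
    (hT : T ∈ E) (h : InvLE (col S.1) (col T.1)) (hne : S ≠ T) :
    ∃ U ∈ E, InvLE (col S.1) (col U.1) ∧ InvLE (col U.1) (col T.1) ∧
      invCount (col U.1) = invCount (col S.1) + 1 := by
  obtain ⟨i, hasc, hτ⟩ := h.exists_step fun he => hne (srct_col_injective he)
  have h₁ := invLE_adjSwap_mul hasc
  have h₂ : InvLE (adjSwap i * col S.1) (col T.1) := fun x z hxz hlt => by
    rcases (adjSwap_mul_inversion hasc hxz).mp hlt with hlt | ⟨rfl, rfl⟩
    · exact h _ _ hxz hlt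
    · exact hτ
  obtain ⟨U, hU, hUσ⟩ := exists_mem_class_of_invLE hE hS hT h₁ h₂
  rw [← hUσ] at h₁ h₂
  exact ⟨U, hU, h₁, h₂, by rw [hUσ, invCount_adjSwap_mul hasc]⟩

/-- The class is graded by the length of the column word, counted from that of the source. -/
theorem nonempty_gradeMinOrder (hE : E ∈ (stSetoid α).classes) :
    letI := classLattice hE; Nonempty (GradeMinOrder ℕ E) := by
  let _ := classLattice hE
  obtain ⟨Z, hZ, hsource⟩ := exists_isSource hE
  have hmin : ∀ T : E, invCount (col Z.1) ≤ invCount (col T.1.1) := fun T =>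
    (hsource.invLE hE hZ T.2).invCount_le
  have hlt : ∀ S T : E, S < T → invCount (col S.1.1) < invCount (col T.1.1) := fun S T h =>
    invCount_lt_of_invLE h.le fun he => h.ne (Subtype.ext he)
  refine ⟨{
    grade := fun T => invCount (col T.1.1) - invCount (col Z.1)
    grade_strictMono := fun S T h => ?_
    covBy_grade := fun S T h => ?_
    isMin_grade := fun T h => ?_ }⟩
  · have h₁ := hmin S
    have h₂ := hlt S T h
    simp only
    omega
  · obtain ⟨U, hU, h₁, h₂, h₃⟩ := exists_cover_in_class hE S.2 T.2 h.le
      fun he => h.ne (Subtype.ext he)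
    have hSU : S < (⟨U, hU⟩ : E) := lt_of_le_of_ne h₁ fun he => by
      rw [he] at h₃
      simp at h₃
    have hUT : (⟨U, hU⟩ : E) = T := by
      by_contra hne
      exact h.2 hSU (lt_of_le_of_ne h₂ hne)
    rw [← hUT, Nat.covBy_iff_add_one_eq]
    have := hmin S
    simp only
    omega
  · have hTZ : T = ⟨Z, hZ⟩ := le_antisymm
      (h (show (⟨Z, hZ⟩ : E) ≤ T from hsource.invLE hE hZ T.2)) (hsource.invLE hE hZ T.2)
    rw [hTZ, Nat.sub_self]
    exact isMin_bot

end ClassOrder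

end SRCTab


theorem theorem6p12 {n : ℕ} (α : Composition n) (E : Set (SRCTab.SRCT α))
    (hE : E ∈ (SRCTab.stSetoid α).classes) :
    (∃ L : Lattice E,
      (∀ S T : E, S ≤ T ↔ SRCTab.FlipLE S.1 T.1) ∧ Nonempty (GradeMinOrder ℕ E)) ∧
    (∃ T₀ T₁ : SRCTab.SRCT α,
      (T₀ ∈ E ∧ SRCTab.IsSource T₀ ∧ ∀ T ∈ E, SRCTab.IsSource T → T = T₀) ∧
      (T₁ ∈ E ∧ SRCTab.IsSink T₁ ∧ ∀ T ∈ E, SRCTab.IsSink T → T = T₁) ∧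
      Set.BijOn (fun T : SRCTab.SRCT α => SRCTab.col T.1) E
        (SRCTab.weakInterval (SRCTab.col T₀.1) (SRCTab.col T₁.1)) ∧
      (∀ S ∈ E, ∀ T ∈ E,
        SRCTab.FlipLE S T ↔ SRCTab.WeakLE (SRCTab.col S.1) (SRCTab.col T.1))) := by
  refine ⟨⟨SRCTab.classLattice hE, fun S T => ?_, SRCTab.nonempty_gradeMinOrder hE⟩, ?_⟩
  · exact (SRCTab.edgeAgree_of_mem_class hE S.2 T.2).flipLE_iff.symm
  · obtain ⟨T₀, h₀, hsource⟩ := SRCTab.exists_isSource hE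
    obtain ⟨T₁, h₁, hsink⟩ := SRCTab.exists_isSink hE
    refine ⟨T₀, T₁, ⟨h₀, hsource, fun T hT h => ?_⟩, ⟨h₁, hsink, fun T hT h => ?_⟩,
      ⟨fun T hT => ?_, fun S _ T _ h => SRCTab.srct_col_injective h, fun σ hσ => ?_⟩,
      fun S hS T hT => ?_⟩
    · exact SRCTab.srct_col_injective ((h.invLE hE hT h₀).antisymm (hsource.invLE hE h₀ hT))
    · exact SRCTab.srct_col_injective ((hsink.invLE hE h₁ hT).antisymm (h.invLE hE hT h₁))
    · exact ⟨SRCTab.weakLE_iff_invLE.mpr (hsource.invLE hE h₀ hT),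
        SRCTab.weakLE_iff_invLE.mpr (hsink.invLE hE h₁ hT)⟩
    · exact SRCTab.exists_mem_class_of_invLE hE h₀ h₁ (SRCTab.weakLE_iff_invLE.mp hσ.1)
        (SRCTab.weakLE_iff_invLE.mp hσ.2)
    · rw [SRCTab.weakLE_iff_invLE]
      exact (SRCTab.edgeAgree_of_mem_class hE hS hT).flipLE_iff
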